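/- \textbf{Setting.} Consider $x_{t+1}=Ax_t+Bu_t$ with $x_t\in\mathbb R^{n_x}$, $u_t\in\mathbb R^{n_u}$, $n_x\ge 1$. Let the columns of $(G_x,G_u)$ be a basis of the null space of $[A-I\ \ B]$, and put $(x_v,u_v)=(G_xv,G_uv)$ for a reference $v$ in a compact convex set $\mathcal V\subset\mathbb R^{n_v}$. For $\sigma\in\mathbb R$ let $\mathcal X^\sigma=\{x: \acute b_x+\sigma\vec 1\le Cx\le \grave b_x-\sigma\vec 1\}$ and $\mathcal U^\sigma=\{u: \acute b_u+\sigma\vec 1\le Du\le \grave b_u-\sigma\vec 1\}$. Assume that $\mathcal X^0\times\mathcal U^0$ is compact and contains $0$ and all $(x_v,u_v)$, $v\in\mathcal V$, in its interior; that $(A,B)$ is stabilizable; and that $P,Q,R\succ0$ satisfy $P=Q+A^TPA-(A^TPB)K$ with $K=(R+B^TPB)^{-1}B^TPA$. For a horizon $N\ge1$ and $\theta=(x,v)$ let $\mathcal P^\sigma(\theta)$ be the problem of minimizing $\|x_N-x_v\|_P^2+\sum_{k=0}^{N-1}(\|x_k-x_v\|_Q^2+\|u_k-u_v\|_R^2)$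 subject to $x_0=x$, $x_{k+1}=Ax_k+Bu_k$, $u_k\in\mathcal U^\sigma$ and $x_{k+1}\in\mathcal X^\sigma$ for $0\le k\le N-1$. Where it is feasible, let $V^\sigma(\theta)$ be its optimal value, $\psi^\sigma(\theta)=\sqrt{V^\sigma(\theta)}$, and $u^{*\sigma}(\theta)$ the first input of its minimizer. Let $H^\chi$ be the block diagonal matrix with $N$ blocks $R$, $N$ blocks $Q$ and one block $P$. Let $\overline\lambda(\cdot)$ be the largest singular value, and $\lambda_{\min},\lambda_{\max}$ the smallest and largest eigenvalue. Let $\beta_\chi>1$ and $\phi$ be such that, over all $\sigma,\sigma'\ge0$ and all $\theta,\theta'$ with references in $\mathcal V$ for which the problems involved are feasible, $$|\psi^\sigma(\theta)-\psi^\sigma(\theta')|\le\beta_\chi\|\theta-\theta'\|,\qquad \|u^{*\sigma}(\theta)-u^{*\sigma'}(\theta)\|\le\phi|\sigma-\sigma'|.$$ \textbf{Optimizer.} $\mathcal P^\sigma(\theta)$ is solved by an iterative optimizer that produces, from any warm start $w_0$, iterates $w_{j+1}=\mathcal T(\mathcal P^\sigma(\theta),w_0,\dots,w_j)$. With it come a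 residual $\mathsf r_j$ and a continuous function $\mathcal D^{\mathsf r}_j$ of $(w_0,\dots,w_j)$. The loop runs while $\sigma^2<\mathcal D^{\mathsf r}_j$ or $\sigma^2<\mathsf r_j^2$; let $\hat j$ be the first index at which it is left. For every feasible problem with $\sigma\ge 0$ and $v\in\mathcal V$, and every warm start, the iterates converge to a state that yields the minimizer. Moreover, if $\hat j$ exists, then $\|\hat u-u^{*\sigma}(\theta)\|^2\le\mathcal D^{\mathsf r}_{\hat j}$, where $\hat u$ is the first input of the sequence extracted from $w_{\hat j}$, and $\mathsf r_{\hat j}\le\sigma$ implies that this sequence is feasible for $\mathcal P^0(\theta)$. Write $\hat u^{\sigma}(\theta)$ for the first input returned (that of $w_{\hat j}$ or, if $\sigma=0$ and the loop is never left, that of the limit of the iterates). \textbf{Constant reference.} Fix $v\in\mathcal V$, reals $\check\Sigma_v,\check\psi_v$, and $p>0$ with $$\{x:\|x-x_v\|_P^2\le p\}\subseteq\{x: -K(x-x_v)+u_v\in\mathcal U^{\check\Sigma_v},\ x\in\mathcal X^{\check\Sigma_v}\}.$$ Put $d=N\lambda_{\min}(Q)/\lambda_{\max}(P)+1$, and $$\check\Gamma=\{x:\mathcal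 P^0(x,v)\text{ feasible},\ \psi^0(x,v)\le\check\psi_v\},\qquad \check\Delta=\{\Sigma:\Sigma\le\check\Sigma_v\}.$$ Assume $\check\psi_v\le\sqrt{dp}$ and $\check\Gamma\subseteq\{x:\mathcal P^{\check\Sigma_v}(x,v)\text{ feasible},\ \psi^{\check\Sigma_v}(x,v)\le\sqrt{dp}\}$. \textbf{Lemma 1.} Let $0<\pi_1,\pi_2<1$. Suppose that at time $t$ we have $\Sigma_t\ge0$ and $(x_t,\Sigma_t)\in\check\Gamma\times\check\Delta$. Let $\theta_t=(x_t,v)$, $x_{t+1}=Ax_t+B\hat u^{\Sigma_t}(\theta_t)$, $\theta_{t+1}=(x_{t+1},v)$ and $\Sigma_{t+1}=\pi_1\Sigma_t+\pi_2\|\theta_{t+1}-\theta_t\|$. Then, whenever $\mathcal P^0(\theta_{t+1})$ is feasible (so that $\psi^0(\theta_{t+1})$ is defined), $$\psi^0(\theta_{t+1})\le(1-\alpha_1)\psi^0(\theta_t)+\zeta_1\Sigma_t,$$ and in any case $$\Sigma_{t+1}\le(1-\alpha_2)\Sigma_t+\zeta_2\psi^0(\theta_t),$$ where $$\alpha_1=1-\sqrt{1-\lambda_{\min}(Q)/\beta_\chi^2},\qquad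 \zeta_1=\overline\lambda(B)\,\beta_\chi(\phi+1),$$ $$\alpha_2=1-\bigl(\pi_1+\pi_2\overline\lambda(B)(\phi+1)\bigr),\qquad \zeta_2=\pi_2\,\frac{\overline\lambda(A-I)+\overline\lambda(B)}{\sqrt{\lambda_{\min}(H^\chi)}}.$$ -/

import Mathlib

open Filter Topology Matrix

/-- Real coordinate space with the Euclidean norm. -/
abbrev Vec (n : ℕ) : Type := EuclideanSpace ℝ (Fin n)

/-- The action `M x` of a real matrix on a vector. -/
noncomputable def act {m n : ℕ} (M : Matrix (Fin m) (Fin n) ℝ) (x : Vec n) : Vec m :=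
  WithLp.toLp 2 (M *ᵥ x.ofLp)

/-- The quadratic form `‖x‖²_M = xᵀ M x`. -/
noncomputable def quad {n : ℕ} (M : Matrix (Fin n) (Fin n) ℝ) (x : Vec n) : ℝ :=
  x.ofLp ⬝ᵥ (M *ᵥ x.ofLp)

/-- Smallest eigenvalue of a (symmetric) real matrix. -/
noncomputable def lamMin {ι : Type} [Fintype ι] [DecidableEq ι] (M : Matrix ι ι ℝ) : ℝ :=
  sInf (spectrum ℝ M)

/-- Largest eigenvalue of a (symmetric) real matrix. -/
noncomputable def lamMax {ι : Type} [Fintype ι] [DecidableEq ι] (M : Matrix ι ι ℝ) : ℝ :=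
  sSup (spectrum ℝ M)

/-- Largest singular value of a real matrix. -/
noncomputable def sigmaMax {m n : ℕ} (M : Matrix (Fin m) (Fin n) ℝ) : ℝ :=
  Real.sqrt (lamMax (Mᵀ * M))

/-- `(A, B)` is stabilizable: some linear state feedback makes all eigenvalues of the closed loop
lie in the open unit disc. -/
def IsStabilizable {nx nu : ℕ} (A : Matrix (Fin nx) (Fin nx) ℝ)
    (B : Matrix (Fin nx) (Fin nu) ℝ) : Prop :=
  ∃ F : Matrix (Fin nu) (Fin nx) ℝ,
    ∀ μ ∈ spectrum ℂ ((A + B * F).map (fun r : ℝ => (r : ℂ))), ‖μ‖ < 1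

/-- The parameter `θ = (x, v)`, with the Euclidean norm. -/
def theta {nx nv : ℕ} (x : Vec nx) (v : Vec nv) : WithLp 2 (Vec nx × Vec nv) :=
  WithLp.toLp 2 (x, v)

/-- Data of a linear-quadratic tracking MPC problem: dynamics `x⁺ = A x + B u`, equilibrium
parametrization `(x_v, u_v) = (Gx v, Gu v)`, weights, constraints `xlo ≤ C x ≤ xhi` and
`ulo ≤ D u ≤ uhi`, and the set of reference commands. -/
structure TrackingMPC (nx nu nv cx cu : ℕ) where
  A : Matrix (Fin nx) (Fin nx) ℝ
  B : Matrix (Fin nx) (Fin nu) ℝ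
  Gx : Matrix (Fin nx) (Fin nv) ℝ
  Gu : Matrix (Fin nu) (Fin nv) ℝ
  P : Matrix (Fin nx) (Fin nx) ℝ
  Q : Matrix (Fin nx) (Fin nx) ℝ
  R : Matrix (Fin nu) (Fin nu) ℝ
  C : Matrix (Fin cx) (Fin nx) ℝ
  D : Matrix (Fin cu) (Fin nu) ℝ
  xlo : Fin cx → ℝ
  xhi : Fin cx → ℝ
  ulo : Fin cu → ℝ
  uhi : Fin cu → ℝ
  refs : Set (Vec nv)

namespace TrackingMPC

variable {nx nu nv cx cu : ℕ} (m : TrackingMPC nx nu nv cx cu)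

/-- The state constraint set tightened by `σ`. -/
def X (σ : ℝ) : Set (Vec nx) :=
  {x | ∀ i, m.xlo i + σ ≤ (act m.C x) i ∧ (act m.C x) i ≤ m.xhi i - σ}

/-- The input constraint set tightened by `σ`. -/
def U (σ : ℝ) : Set (Vec nu) :=
  {u | ∀ i, m.ulo i + σ ≤ (act m.D u) i ∧ (act m.D u) i ≤ m.uhi i - σ}

/-- The LQR gain `K = (R + Bᵀ P B)⁻¹ (Bᵀ P A)`. -/
noncomputable def K : Matrix (Fin nu) (Fin nx) ℝ :=
  (m.R + m.Bᵀ * m.P * m.B)⁻¹ * (m.Bᵀ * m.P * m.A)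

/-- Standing assumptions on the problem data. -/
structure Assumptions : Prop where
  /-- `(Gx, Gu)` is a basis of the null space of `[A - I, B]`. -/
  null : (m.A - 1) * m.Gx + m.B * m.Gu = 0
  null_indep : ∀ v : Vec nv, act m.Gx v = 0 → act m.Gu v = 0 → v = 0
  null_span : ∀ (x : Vec nx) (u : Vec nu), act (m.A - 1) x + act m.B u = 0 →
    ∃ v : Vec nv, x = act m.Gx v ∧ u = act m.Gu v
  /-- The set of reference commands is compact and convex. -/
  refs_compact : IsCompact m.refs
  refs_convex : Convex ℝ m.refs
  /-- The constraint set is compact, and contains the origin and all equilibrium pairs of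
  reference commands in its interior. -/
  compact : IsCompact (m.X 0 ×ˢ m.U 0)
  zero_mem : ((0, 0) : Vec nx × Vec nu) ∈ interior (m.X 0 ×ˢ m.U 0)
  equilibrium_mem : ∀ v ∈ m.refs, (act m.Gx v, act m.Gu v) ∈ interior (m.X 0 ×ˢ m.U 0)
  stabilizable : IsStabilizable m.A m.B
  /-- Positive definite weights satisfying the Riccati equation. -/
  posDef_P : m.P.PosDef
  posDef_Q : m.Q.PosDef
  posDef_R : m.R.PosDef
  riccati : m.P = m.Q + m.Aᵀ * m.P * m.A - (m.Aᵀ * m.P * m.B) * m.K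

/-- The predicted states `x_0, x_1, …, x_N` from `x` under the input sequence `η` (the values
beyond index `N` are not used). -/
noncomputable def pred {N : ℕ} (x : Vec nx) (η : Fin N → Vec nu) : ℕ → Vec nx
  | 0 => x
  | k + 1 => act m.A (pred x η k) + act m.B (if h : k < N then η ⟨k, h⟩ else 0)

/-- Feasibility of the input sequence `η` for the problem tightened by `σ`: inputs `u_0, …, u_{N-1}`
and predicted states `x_1, …, x_N` satisfy the tightened constraints. -/
def Feasible {N : ℕ} (σ : ℝ) (x : Vec nx) (η : Fin N → Vec nu) : Prop :=
  (∀ k : Fin N, η k ∈ m.U σ) ∧ ∀ k : Fin N, m.pred x η ((k : ℕ) + 1) ∈ m.X σ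

/-- The tracking cost of the input sequence `η`. -/
noncomputable def cost {N : ℕ} (x : Vec nx) (v : Vec nv) (η : Fin N → Vec nu) : ℝ :=
  quad m.P (m.pred x η N - act m.Gx v) +
    ∑ k : Fin N, (quad m.Q (m.pred x η (k : ℕ) - act m.Gx v) + quad m.R (η k - act m.Gu v))

/-- `η` is a minimizer of the tightened problem at `θ = (x, v)`. -/
def IsOptimal {N : ℕ} (σ : ℝ) (x : Vec nx) (v : Vec nv) (η : Fin N → Vec nu) : Prop :=
  m.Feasible σ x η ∧ ∀ η' : Fin N → Vec nu, m.Feasible σ x η' → m.cost x v η ≤ m.cost x v η'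

/-- The set of feasible initial states of the problem tightened by `σ`, with horizon `N`. -/
def feasibleStates (N : ℕ) (σ : ℝ) : Set (Vec nx) :=
  {x | ∃ η : Fin N → Vec nu, m.Feasible σ x η}

/-- The optimal value function. It is meaningful for `x ∈ feasibleStates N σ` only. -/
noncomputable def value (N : ℕ) (σ : ℝ) (x : Vec nx) (v : Vec nv) : ℝ :=
  sInf {c | ∃ η : Fin N → Vec nu, m.Feasible σ x η ∧ c = m.cost x v η}

/-- The square root of the optimal value function. -/
noncomputable def psi (N : ℕ) (σ : ℝ) (x : Vec nx) (v : Vec nv) : ℝ :=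
  Real.sqrt (m.value N σ x v)

/-- The block diagonal weight of `χ = (u_0, …, u_{N-1}, x_0, …, x_N)`, with diagonal blocks
`R` (`N` times), `Q` (`N` times) and `P`. -/
def Hchi (N : ℕ) :
    Matrix ((Fin nu × Fin N) ⊕ ((Fin nx × Fin N) ⊕ Fin nx))
      ((Fin nu × Fin N) ⊕ ((Fin nx × Fin N) ⊕ Fin nx)) ℝ :=
  Matrix.fromBlocks (Matrix.blockDiagonal fun _ : Fin N => m.R) 0 0
    (Matrix.fromBlocks (Matrix.blockDiagonal fun _ : Fin N => m.Q) 0 0 m.P)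

/-- `β` is a Lipschitz constant of `θ ↦ ψ^σ(θ)`, for every tightening parameter `σ ≥ 0`. -/
def IsValueLipschitzConst (N : ℕ) (β : ℝ) : Prop :=
  ∀ σ : ℝ, 0 ≤ σ → ∀ xa ∈ m.feasibleStates N σ, ∀ xb ∈ m.feasibleStates N σ,
    ∀ va ∈ m.refs, ∀ vb ∈ m.refs,
      |m.psi N σ xa va - m.psi N σ xb vb| ≤ β * ‖theta xa va - theta xb vb‖

/-- `φ` is a Lipschitz constant of the dependence of the first optimal input `u^{*σ}(θ)` on `σ`. -/
def IsInputLipschitzConst (N : ℕ) [NeZero N] (φ : ℝ) : Prop :=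
  ∀ σa σb : ℝ, 0 ≤ σa → 0 ≤ σb → ∀ (x : Vec nx), ∀ v ∈ m.refs, ∀ ηa ηb : Fin N → Vec nu,
    m.IsOptimal σa x v ηa → m.IsOptimal σb x v ηb → ‖ηa 0 - ηb 0‖ ≤ φ * |σa - σb|

/-- `p > 0` is such that the terminal set `{x | F(x - x_v) ≤ p}` is contained in the set of states
where `x` and the LQR input satisfy the constraints tightened by `σ`. -/
def IsTerminalLevel (σ : ℝ) (v : Vec nv) (p : ℝ) : Prop :=
  0 < p ∧ ∀ x : Vec nx, quad m.P (x - act m.Gx v) ≤ p →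
    -act m.K (x - act m.Gx v) + act m.Gu v ∈ m.U σ ∧ x ∈ m.X σ

/-- `d = N λ_min(Q) / λ_max(P) + 1`. -/
noncomputable def d (N : ℕ) : ℝ := N * lamMin m.Q / lamMax m.P + 1

/-- The region of attraction estimate `Γ^σ(v)` associated with the terminal level `p`. -/
def Gam (N : ℕ) (σ : ℝ) (v : Vec nv) (p : ℝ) : Set (Vec nx) :=
  {x | x ∈ m.feasibleStates N σ ∧ m.psi N σ x v ≤ Real.sqrt (m.d N * p)}

/-- The sublevel set of `ψ⁰(·, v)` at the level `ψc`. -/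
def GamCheck (N : ℕ) (v : Vec nv) (ψc : ℝ) : Set (Vec nx) :=
  {x | x ∈ m.feasibleStates N 0 ∧ m.psi N 0 x v ≤ ψc}

end TrackingMPC

/-- An iterative optimizer for the tightened problems, with optimizer states in `W`. A history up to
iteration `j` is a map `Fin (j + 1) → W`. -/
structure Optimizer (nx nu nv N : ℕ) (W : Type*) where
  /-- The next optimizer state, for the problem with parameters `σ` and `(x, v)`. -/
  step : ℝ → Vec nx → Vec nv → (j : ℕ) → (Fin (j + 1) → W) → W
  /-- The input sequence extracted from an optimizer state. -/
  inputs : ℝ → Vec nx → Vec nv → W → (Fin N → Vec nu)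
  /-- The primal residual at iteration `j`. -/
  residual : ℝ → Vec nx → Vec nv → (j : ℕ) → (Fin (j + 1) → W) → ℝ
  /-- The suboptimality estimate used in the termination criterion. -/
  subopt : (j : ℕ) → (Fin (j + 1) → W) → ℝ

namespace Optimizer

variable {nx nu nv cx cu N : ℕ} {W : Type*} (opt : Optimizer nx nu nv N W)

/-- `w` is the sequence of iterates of the optimizer for the given problem (from `w 0`). -/
def IsIterates (σ : ℝ) (x : Vec nx) (v : Vec nv) (w : ℕ → W) : Prop :=
  ∀ j, w (j + 1) = opt.step σ x v j (fun i => w i)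

/-- The termination criterion: the loop "while `σ² < subopt` or `σ² < residual²`" is left. -/
def Stops (σ : ℝ) (x : Vec nx) (v : Vec nv) (w : ℕ → W) (j : ℕ) : Prop :=
  opt.subopt j (fun i => w i) ≤ σ ^ 2 ∧ (opt.residual σ x v j (fun i => w i)) ^ 2 ≤ σ ^ 2

/-- The class of optimizers under consideration: globally convergent to the minimizer of every
feasible problem and, at the iteration `j` at which the loop is left, the residual certifies
feasibility for the problem without tightening, and `subopt` bounds the squared error of the first
input. -/
structure IsAdmissible [TopologicalSpace W] [NeZero N] (m : TrackingMPC nx nu nv cx cu) : Prop where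
  continuous_subopt : ∀ j, Continuous (opt.subopt j)
  converges : ∀ (σ : ℝ) (x : Vec nx) (v : Vec nv) (w : ℕ → W), 0 ≤ σ →
    x ∈ m.feasibleStates N σ → v ∈ m.refs → opt.IsIterates σ x v w →
    ∃ ws : W, Tendsto w atTop (𝓝 ws) ∧ m.IsOptimal σ x v (opt.inputs σ x v ws)
  feasible_of_residual : ∀ (σ : ℝ) (x : Vec nx) (v : Vec nv) (w : ℕ → W) (j : ℕ), 0 ≤ σ →
    x ∈ m.feasibleStates N σ → v ∈ m.refs → opt.IsIterates σ x v w →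
    IsLeast {i | opt.Stops σ x v w i} j →
    opt.residual σ x v j (fun i => w i) ≤ σ → m.Feasible 0 x (opt.inputs σ x v (w j))
  subopt_bound : ∀ (σ : ℝ) (x : Vec nx) (v : Vec nv) (w : ℕ → W) (j : ℕ), 0 ≤ σ →
    x ∈ m.feasibleStates N σ → v ∈ m.refs → opt.IsIterates σ x v w →
    IsLeast {i | opt.Stops σ x v w i} j →
    ∀ η : Fin N → Vec nu, m.IsOptimal σ x v η →
      ‖opt.inputs σ x v (w j) 0 - η 0‖ ^ 2 ≤ opt.subopt j (fun i => w i)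

/-- `w` is returned by the inexact solution of the problem warm-started at `w0`: it is the iterate
at which the loop is left or, if `σ = 0` and the loop is never left, the limit of the iterates. -/
def Returns [TopologicalSpace W] (σ : ℝ) (x : Vec nx) (v : Vec nv) (w0 w : W) : Prop :=
  ∃ it : ℕ → W, it 0 = w0 ∧ opt.IsIterates σ x v it ∧
    ((∃ j, IsLeast {i | opt.Stops σ x v it i} j ∧ w = it j) ∨
      (σ = 0 ∧ (∀ i, ¬ opt.Stops σ x v it i) ∧ Tendsto it atTop (𝓝 w)))

end Optimizer

/-- `α₁ = 1 - √(1 - λ_min(Q) / β²)`. -/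
noncomputable def alpha1 {nx nu nv cx cu : ℕ} (m : TrackingMPC nx nu nv cx cu) (β : ℝ) : ℝ :=
  1 - Real.sqrt (1 - lamMin m.Q / β ^ 2)

/-- `ζ₁ = √λ_max(Bᵀ B) β (φ + 1)`. -/
noncomputable def zeta1 {nx nu nv cx cu : ℕ} (m : TrackingMPC nx nu nv cx cu) (β φ : ℝ) : ℝ :=
  sigmaMax m.B * β * (φ + 1)

/-- `α₂ = 1 - (π₁ + π₂ σ_max(B) (φ + 1))`. -/
noncomputable def alpha2 {nx nu nv cx cu : ℕ} (m : TrackingMPC nx nu nv cx cu)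
    (φ π₁ π₂ : ℝ) : ℝ :=
  1 - (π₁ + π₂ * sigmaMax m.B * (φ + 1))

/-- `ζ₂ = π₂ (σ_max(A - I) + σ_max(B)) / √λ_min(H^χ)`. -/
noncomputable def zeta2 {nx nu nv cx cu : ℕ} (m : TrackingMPC nx nu nv cx cu) (N : ℕ)
    (π₂ : ℝ) : ℝ :=
  π₂ * ((sigmaMax (m.A - 1) + sigmaMax m.B) / Real.sqrt (lamMin (m.Hchi N)))

/-! The returned input is a perturbation of the first input of the untightened minimizer. The
stopping test puts it within `S t` of the tightened minimizer's first input, which is within `φ * S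
t` of the untightened one. The total error is at most `(φ + 1) * S t`.

For the exact input, `psi` contracts. A value of at most `m.d N * p` forces the optimal terminal
state into the terminal set (`IsOptimal.terminalCost_le`). The shifted plan followed by one LQR step
is then feasible, and the value drops by at least the stage cost
(`IsOptimal.exists_feasible_successor`). That drop is a fixed fraction of the value, because `psi`
is `β`-Lipschitz and vanishes at the equilibrium. The Lipschitz bound then carries the estimate over
to the perturbed successor.

For the tightening parameter, subtracting the equilibrium equation writes the state increment in
terms of the deviations of `x t` and of the optimal input from equilibrium, plus the input error.
The optimal cost controls both deviations through `lamMin (m.Hchi N)`. -/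

section LinearAlgebra

/-! ### Rayleigh bounds, singular values and positive definite block matrices -/

/-- Subtracting a scalar matrix shifts the spectrum, so the difference has nonnegative spectrum and
is positive semidefinite. -/
theorem lamMin_mul_dotProduct_le {ι : Type} [Fintype ι] [DecidableEq ι] {M : Matrix ι ι ℝ}
    (hM : M.IsHermitian) (z : ι → ℝ) : lamMin M * (z ⬝ᵥ z) ≤ z ⬝ᵥ (M *ᵥ z) := by
  have h : (M - algebraMap ℝ (Matrix ι ι ℝ) (lamMin M)).PosSemidef := by
    rw [posSemidef_iff_isHermitian_and_spectrum_nonneg]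
    refine ⟨hM.sub ?_, ?_⟩
    · rw [Algebra.algebraMap_eq_smul_one]
      exact isHermitian_one.smul (by simp [IsSelfAdjoint])
    · rw [← spectrum.sub_singleton_eq]
      rintro _ ⟨a, ha, b, rfl, rfl⟩
      exact sub_nonneg.2 (csInf_le M.finite_real_spectrum.bddBelow ha)
  have := h.dotProduct_mulVec_nonneg z
  simp only [star_trivial, Algebra.algebraMap_eq_smul_one, sub_mulVec, smul_mulVec, one_mulVec,
    dotProduct_sub, dotProduct_smul, smul_eq_mul] at this
  linarith

theorem dotProduct_mulVec_le_lamMax {ι : Type} [Fintype ι] [DecidableEq ι] {M : Matrix ι ι ℝ}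
    (hM : M.IsHermitian) (z : ι → ℝ) : z ⬝ᵥ (M *ᵥ z) ≤ lamMax M * (z ⬝ᵥ z) := by
  have h : (algebraMap ℝ (Matrix ι ι ℝ) (lamMax M) - M).PosSemidef := by
    rw [posSemidef_iff_isHermitian_and_spectrum_nonneg]
    refine ⟨IsHermitian.sub ?_ hM, ?_⟩
    · rw [Algebra.algebraMap_eq_smul_one]
      exact isHermitian_one.smul (by simp [IsSelfAdjoint])
    · rw [← spectrum.singleton_sub_eq]
      rintro _ ⟨b, rfl, a, ha, rfl⟩
      exact sub_nonneg.2 (le_csSup M.finite_real_spectrum.bddAbove ha)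
  have := h.dotProduct_mulVec_nonneg z
  simp only [star_trivial, Algebra.algebraMap_eq_smul_one, sub_mulVec, smul_mulVec, one_mulVec,
    dotProduct_sub, dotProduct_smul, smul_eq_mul] at this
  linarith

theorem lamMin_pos {ι : Type} [Fintype ι] [DecidableEq ι] [Nonempty ι] {M : Matrix ι ι ℝ}
    (hM : M.PosDef) : 0 < lamMin M := by
  -- Nonemptiness is essential: the infimum of an empty spectrum would be `0` by convention.
  have hne : (spectrum ℝ M).Nonempty := by
    rw [hM.isHermitian.spectrum_real_eq_range_eigenvalues]
    exact Set.range_nonempty _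
  have hmem : lamMin M ∈ spectrum ℝ M := hne.csInf_mem M.finite_real_spectrum
  rw [hM.isHermitian.spectrum_real_eq_range_eigenvalues] at hmem
  obtain ⟨i, hi⟩ := hmem
  exact hi ▸ hM.eigenvalues_pos i

theorem lamMax_pos {ι : Type} [Fintype ι] [DecidableEq ι] [Nonempty ι] {M : Matrix ι ι ℝ}
    (hM : M.PosDef) : 0 < lamMax M := by
  obtain ⟨i⟩ := ‹Nonempty ι›
  refine (hM.eigenvalues_pos i).trans_le (le_csSup M.finite_real_spectrum.bddAbove ?_)
  exact hM.isHermitian.eigenvalues_mem_spectrum_real i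

variable {l n k : ℕ}

theorem act_add (M : Matrix (Fin l) (Fin n) ℝ) (x y : Vec n) : act M (x + y) = act M x + act M y := by
  ext i; simp [act, mulVec_add]

theorem act_sub (M : Matrix (Fin l) (Fin n) ℝ) (x y : Vec n) : act M (x - y) = act M x - act M y := by
  ext i; simp [act, mulVec_sub]

theorem act_neg (M : Matrix (Fin l) (Fin n) ℝ) (x : Vec n) : act M (-x) = -act M x := by
  ext i; simp [act, mulVec_neg]

theorem add_act (M M' : Matrix (Fin l) (Fin n) ℝ) (x : Vec n) :
    act (M + M') x = act M x + act M' x := by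
  ext i; simp [act, add_mulVec]

theorem sub_act (M M' : Matrix (Fin l) (Fin n) ℝ) (x : Vec n) :
    act (M - M') x = act M x - act M' x := by
  ext i; simp [act, sub_mulVec]

theorem one_act (x : Vec n) : act (1 : Matrix (Fin n) (Fin n) ℝ) x = x := by
  ext i; simp [act]

theorem mul_act (M : Matrix (Fin l) (Fin n) ℝ) (M' : Matrix (Fin n) (Fin k) ℝ) (x : Vec k) :
    act (M * M') x = act M (act M' x) := by
  ext i; simp [act]

theorem dotProduct_self_eq_norm_sq (x : Vec n) : x.ofLp ⬝ᵥ x.ofLp = ‖x‖ ^ 2 := by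
  rw [EuclideanSpace.real_norm_sq_eq]
  simp [dotProduct, sq]

theorem quad_transpose_mul_mul (M : Matrix (Fin l) (Fin l) ℝ) (L : Matrix (Fin l) (Fin n) ℝ)
    (x : Vec n) : quad (Lᵀ * M * L) x = quad M (act L x) := by
  simp only [quad, act]
  rw [dotProduct_mulVec, dotProduct_mulVec, ← vecMul_vecMul, ← vecMul_vecMul, vecMul_transpose,
    ← dotProduct_mulVec]

theorem quad_add (M M' : Matrix (Fin n) (Fin n) ℝ) (x : Vec n) :
    quad (M + M') x = quad M x + quad M' x := by
  simp [quad, add_mulVec]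

theorem quad_nonneg {M : Matrix (Fin n) (Fin n) ℝ} (hM : M.PosDef) (x : Vec n) : 0 ≤ quad M x := by
  simpa [quad] using hM.posSemidef.dotProduct_mulVec_nonneg x.ofLp

theorem quad_zero (M : Matrix (Fin n) (Fin n) ℝ) : quad M 0 = 0 := by
  simp [quad]

theorem lamMin_mul_norm_sq_le_quad {M : Matrix (Fin n) (Fin n) ℝ} (hM : M.PosDef) (x : Vec n) :
    lamMin M * ‖x‖ ^ 2 ≤ quad M x := by
  rw [← dotProduct_self_eq_norm_sq]
  exact lamMin_mul_dotProduct_le hM.isHermitian _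

theorem quad_le_lamMax_mul_norm_sq {M : Matrix (Fin n) (Fin n) ℝ} (hM : M.PosDef) (x : Vec n) :
    quad M x ≤ lamMax M * ‖x‖ ^ 2 := by
  rw [← dotProduct_self_eq_norm_sq]
  exact dotProduct_mulVec_le_lamMax hM.isHermitian _

theorem norm_act_le (M : Matrix (Fin l) (Fin n) ℝ) (x : Vec n) : ‖act M x‖ ≤ sigmaMax M * ‖x‖ := by
  have h := dotProduct_mulVec_le_lamMax (M := Mᵀ * M) (isHermitian_conjTranspose_mul_self M) x.ofLp
  have h1 : x.ofLp ⬝ᵥ ((Mᵀ * M) *ᵥ x.ofLp) = ‖act M x‖ ^ 2 := by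
    rw [← dotProduct_self_eq_norm_sq, ← mulVec_mulVec, dotProduct_mulVec, vecMul_transpose]
    rfl
  rw [h1, dotProduct_self_eq_norm_sq] at h
  rw [sigmaMax, ← Real.sqrt_sq (norm_nonneg x), ← Real.sqrt_mul' _ (sq_nonneg _)]
  exact Real.le_sqrt_of_sq_le h

theorem sigmaMax_nonneg (M : Matrix (Fin l) (Fin n) ℝ) : 0 ≤ sigmaMax M := Real.sqrt_nonneg _

theorem norm_theta_sub (x y : Vec n) (v : Vec k) : ‖theta x v - theta y v‖ = ‖x - y‖ := by
  rw [theta, theta, ← WithLp.toLp_sub, Prod.mk_sub_mk, sub_self]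
  simp

theorem posDef_blockDiagonal {n N : ℕ} {M : Matrix (Fin n) (Fin n) ℝ} (hM : M.PosDef) :
    (blockDiagonal fun _ : Fin N => M).PosDef := by
  refine .of_dotProduct_mulVec_pos ?_ fun z hz => ?_
  · rw [IsHermitian, blockDiagonal_conjTranspose]
    simp only [hM.isHermitian.eq]
  · have key : star z ⬝ᵥ ((blockDiagonal fun _ : Fin N => M) *ᵥ z) =
        ∑ j, (fun i => z (i, j)) ⬝ᵥ (M *ᵥ fun i => z (i, j)) := by
      simp only [dotProduct, mulVec, Fintype.sum_prod_type, blockDiagonal_apply, star_trivial]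
      rw [Finset.sum_comm]
      simp
    rw [key]
    obtain ⟨⟨i, j⟩, hij⟩ := Function.ne_iff.1 hz
    refine Finset.sum_pos' (fun j _ => ?_) ⟨j, Finset.mem_univ _, ?_⟩
    · simpa using hM.posSemidef.dotProduct_mulVec_nonneg (fun i => z (i, j))
    · simpa using hM.dotProduct_mulVec_pos (x := fun i => z (i, j))
        (Function.ne_iff.2 ⟨i, by simpa using hij⟩)

theorem posDef_fromBlocks_diagonal {ι κ : Type} [Fintype ι] [Fintype κ] [DecidableEq ι]
    [DecidableEq κ] {M : Matrix ι ι ℝ} {M' : Matrix κ κ ℝ} (hM : M.PosDef) (hM' : M'.PosDef) :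
    (fromBlocks M 0 0 M').PosDef := by
  refine .of_dotProduct_mulVec_pos ?_ fun z hz => ?_
  · rw [IsHermitian, fromBlocks_conjTranspose]
    rw [hM.isHermitian.eq, hM'.isHermitian.eq, conjTranspose_zero, conjTranspose_zero]
  · have key : star z ⬝ᵥ (fromBlocks M 0 0 M' *ᵥ z) =
        (z ∘ Sum.inl) ⬝ᵥ (M *ᵥ (z ∘ Sum.inl)) + (z ∘ Sum.inr) ⬝ᵥ (M' *ᵥ (z ∘ Sum.inr)) := by
      rw [fromBlocks_mulVec]
      simp [dotProduct]
    rw [key]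
    have h1 : 0 ≤ (z ∘ Sum.inl) ⬝ᵥ (M *ᵥ (z ∘ Sum.inl)) := by
      simpa using hM.posSemidef.dotProduct_mulVec_nonneg (z ∘ Sum.inl)
    have h2 : 0 ≤ (z ∘ Sum.inr) ⬝ᵥ (M' *ᵥ (z ∘ Sum.inr)) := by
      simpa using hM'.posSemidef.dotProduct_mulVec_nonneg (z ∘ Sum.inr)
    obtain ⟨i | i, hi⟩ := Function.ne_iff.1 hz
    · have := hM.dotProduct_mulVec_pos (x := z ∘ Sum.inl) (Function.ne_iff.2 ⟨i, hi⟩)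
      simp only [star_trivial] at this
      linarith
    · have := hM'.dotProduct_mulVec_pos (x := z ∘ Sum.inr) (Function.ne_iff.2 ⟨i, hi⟩)
      simp only [star_trivial] at this
      linarith

end LinearAlgebra

/-! ### Blockwise bounds from the stacked weight -/

namespace TrackingMPC

variable {nx nu nv cx cu : ℕ} {m : TrackingMPC nx nu nv cx cu}

theorem Assumptions.posDef_Hchi (hm : m.Assumptions) (N : ℕ) : (m.Hchi N).PosDef :=
  posDef_fromBlocks_diagonal (posDef_blockDiagonal hm.posDef_R)
    (posDef_fromBlocks_diagonal (posDef_blockDiagonal hm.posDef_Q) hm.posDef_P)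

theorem Assumptions.lamMin_Hchi_le_quad_Q (hm : m.Assumptions) {N : ℕ} (j : Fin N) (y : Vec nx) :
    lamMin (m.Hchi N) * ‖y‖ ^ 2 ≤ quad m.Q y := by
  -- The test vector carries `y` in the `j`-th `Q` block and zero elsewhere.
  have h := lamMin_mul_dotProduct_le (hm.posDef_Hchi N).isHermitian
    (Sum.elim 0 (Sum.elim (fun q => if q.2 = j then y q.1 else 0) 0))
  rw [← dotProduct_self_eq_norm_sq]
  simpa [Hchi, fromBlocks_mulVec, dotProduct, mulVec, Fintype.sum_prod_type, blockDiagonal_apply,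
    quad] using h

theorem Assumptions.lamMin_Hchi_le_quad_R (hm : m.Assumptions) {N : ℕ} (j : Fin N) (y : Vec nu) :
    lamMin (m.Hchi N) * ‖y‖ ^ 2 ≤ quad m.R y := by
  have h := lamMin_mul_dotProduct_le (hm.posDef_Hchi N).isHermitian
    (Sum.elim (fun q => if q.2 = j then y q.1 else 0) 0)
  rw [← dotProduct_self_eq_norm_sq]
  simpa [Hchi, fromBlocks_mulVec, dotProduct, mulVec, Fintype.sum_prod_type, blockDiagonal_apply,
    quad] using h

end TrackingMPC

/-! ### LQR feedback and continuation of trajectories -/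

namespace TrackingMPC

variable {nx nu nv cx cu : ℕ} (m : TrackingMPC nx nu nv cx cu)

/-- The stage cost `‖x - x_v‖²_Q + ‖u - u_v‖²_R`. -/
noncomputable def stageCost (v : Vec nv) (x : Vec nx) (u : Vec nu) : ℝ :=
  quad m.Q (x - act m.Gx v) + quad m.R (u - act m.Gu v)

/-- The terminal cost `‖x - x_v‖²_P`. -/
noncomputable def terminalCost (v : Vec nv) (x : Vec nx) : ℝ :=
  quad m.P (x - act m.Gx v)

/-- The LQR feedback law around the equilibrium of `v`. -/
noncomputable def lqr (v : Vec nv) (x : Vec nx) : Vec nu :=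
  -act m.K (x - act m.Gx v) + act m.Gu v

variable {m}

theorem Assumptions.stageCost_nonneg (hm : m.Assumptions) (v : Vec nv) (x : Vec nx) (u : Vec nu) :
    0 ≤ m.stageCost v x u :=
  add_nonneg (quad_nonneg hm.posDef_Q _) (quad_nonneg hm.posDef_R _)

theorem Assumptions.act_equilibrium (hm : m.Assumptions) (v : Vec nv) :
    act m.A (act m.Gx v) + act m.B (act m.Gu v) = act m.Gx v := by
  have h : act ((m.A - 1) * m.Gx + m.B * m.Gu) v = 0 := by
    rw [hm.null]; ext i; simp [act]
  rw [add_act, mul_act, mul_act, sub_act, one_act] at h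
  rw [← sub_eq_zero, ← h]
  abel

/-- Lyapunov form of the Riccati equation: the defining relation of the gain, `hK`, cancels the
cross terms. -/
theorem Assumptions.riccati_closedLoop (hm : m.Assumptions) :
    (m.A - m.B * m.K)ᵀ * m.P * (m.A - m.B * m.K) + m.Q + m.Kᵀ * m.R * m.K = m.P := by
  have hS : IsUnit (m.R + m.Bᵀ * m.P * m.B) := by
    have := hm.posDef_P.posSemidef.conjTranspose_mul_mul_same m.B
    rw [conjTranspose_eq_transpose_of_trivial] at this
    exact (hm.posDef_R.add_posSemidef this).isUnit
  have hK : (m.R + m.Bᵀ * m.P * m.B) * m.K = m.Bᵀ * m.P * m.A := by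
    rw [K, mul_nonsing_inv_cancel_left _ _ ((isUnit_iff_isUnit_det _).1 hS)]
  have hK' : m.Kᵀ * m.R * m.K = m.Kᵀ * (m.Bᵀ * m.P * m.A) - m.Kᵀ * (m.Bᵀ * m.P * m.B) * m.K := by
    rw [← hK]
    simp only [Matrix.add_mul, Matrix.mul_add, Matrix.mul_assoc]
    abel
  have hr := hm.riccati
  rw [hK', transpose_sub, transpose_mul]
  conv_rhs => rw [hr]
  simp only [Matrix.sub_mul, Matrix.mul_sub, Matrix.mul_assoc]
  abel

theorem Assumptions.terminalCost_lqr (hm : m.Assumptions) (v : Vec nv) (x : Vec nx) :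
    m.terminalCost v (act m.A x + act m.B (m.lqr v x)) + m.stageCost v x (m.lqr v x) =
      m.terminalCost v x := by
  have h1 : act m.A x + act m.B (m.lqr v x) - act m.Gx v =
      act (m.A - m.B * m.K) (x - act m.Gx v) := by
    conv_lhs => rw [← hm.act_equilibrium v]
    simp only [lqr, sub_act, mul_act, act_add, act_sub, act_neg]
    abel
  have h2 : m.lqr v x - act m.Gu v = act (-m.K) (x - act m.Gx v) := by
    rw [lqr, add_sub_cancel_right]
    ext i; simp [act, neg_mulVec]
  rw [terminalCost, terminalCost, stageCost, h1, h2, ← quad_transpose_mul_mul,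
    ← quad_transpose_mul_mul, ← add_assoc, ← quad_add, ← quad_add]
  conv_rhs => rw [← hm.riccati_closedLoop]
  simp

/-- Lets plans be handled as infinite trajectories, free of `Fin` indices. The bound `j ≤ N` is
needed since `pred` applies zero input from step `N` on. -/
theorem pred_eq_of_dynamics {N : ℕ} {y : ℕ → Vec nx} {u : ℕ → Vec nu}
    (hy : ∀ j, y (j + 1) = act m.A (y j) + act m.B (u j)) :
    ∀ j ≤ N, m.pred (y 0) (fun k : Fin N => u k) j = y j := by
  intro j hj
  induction j with
  | zero => rfl
  | succ j ih =>
    rw [pred, ih (by omega), hy, dif_pos (by omega)]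

theorem cost_eq_of_dynamics {N : ℕ} {y : ℕ → Vec nx} {u : ℕ → Vec nu}
    (hy : ∀ j, y (j + 1) = act m.A (y j) + act m.B (u j)) (v : Vec nv) :
    m.cost (y 0) v (fun k : Fin N => u k) =
      ∑ j ∈ Finset.range N, m.stageCost v (y j) (u j) + m.terminalCost v (y N) := by
  rw [cost, pred_eq_of_dynamics hy N le_rfl, add_comm, ← Fin.sum_univ_eq_sum_range
    (fun j => m.stageCost v (y j) (u j)) N]
  congr 1
  exact Finset.sum_congr rfl fun k _ => by rw [pred_eq_of_dynamics hy k k.2.le]; rfl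

theorem feasible_iff_of_dynamics {N : ℕ} {y : ℕ → Vec nx} {u : ℕ → Vec nu}
    (hy : ∀ j, y (j + 1) = act m.A (y j) + act m.B (u j)) (σ : ℝ) :
    m.Feasible σ (y 0) (fun k : Fin N => u k) ↔
      ∀ j < N, u j ∈ m.U σ ∧ y (j + 1) ∈ m.X σ := by
  constructor
  · rintro ⟨h1, h2⟩ j hj
    refine ⟨h1 ⟨j, hj⟩, ?_⟩
    have := h2 ⟨j, hj⟩
    rwa [pred_eq_of_dynamics hy (j + 1) hj] at this
  · refine fun h => ⟨fun k => (h k k.2).1, fun k => ?_⟩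
    rw [pred_eq_of_dynamics hy (k + 1) k.2]
    exact (h k k.2).2

/-- Every input sequence can be continued by the LQR feedback after any number `k ≤ N` of steps. -/
theorem exists_lqr_continuation {N : ℕ} (x : Vec nx) (v : Vec nv) (η : Fin N → Vec nu) {k : ℕ}
    (hk : k ≤ N) :
    ∃ (y : ℕ → Vec nx) (u : ℕ → Vec nu), y 0 = x ∧
      (∀ j, y (j + 1) = act m.A (y j) + act m.B (u j)) ∧
      (∀ j (hj : j < k), u j = η ⟨j, hj.trans_le hk⟩) ∧
      (∀ j, k ≤ j → u j = m.lqr v (y j)) := by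
  let f : ℕ → Vec nx → Vec nu := fun j z =>
    if h : j < k then η ⟨j, h.trans_le hk⟩ else m.lqr v z
  let y : ℕ → Vec nx := fun j => Nat.rec x (fun i z => act m.A z + act m.B (f i z)) j
  exact ⟨y, fun j => f j (y j), rfl, fun j => rfl, fun j hj => dif_pos hj,
    fun j hj => dif_neg hj.not_gt⟩

section Continuation

variable {y : ℕ → Vec nx} {u : ℕ → Vec nu} {v : Vec nv} {k : ℕ}

/-- The terminal cost is the exact LQR cost-to-go, so once LQR has taken over the total does not
depend on where the sum is cut. -/
theorem Assumptions.sum_stageCost_add_terminalCost (hm : m.Assumptions)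
    (hy : ∀ j, y (j + 1) = act m.A (y j) + act m.B (u j)) (hu : ∀ j, k ≤ j → u j = m.lqr v (y j))
    {j : ℕ} (hj : k ≤ j) :
    ∑ i ∈ Finset.range j, m.stageCost v (y i) (u i) + m.terminalCost v (y j) =
      ∑ i ∈ Finset.range k, m.stageCost v (y i) (u i) + m.terminalCost v (y k) := by
  induction j, hj using Nat.le_induction with
  | base => rfl
  | succ j hj ih =>
    rw [← ih, Finset.sum_range_succ, hy, hu j hj, ← hm.terminalCost_lqr v (y j)]
    ring

theorem Assumptions.terminalCost_le_of_lqr (hm : m.Assumptions)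
    (hy : ∀ j, y (j + 1) = act m.A (y j) + act m.B (u j)) (hu : ∀ j, k ≤ j → u j = m.lqr v (y j))
    {j : ℕ} (hj : k ≤ j) : m.terminalCost v (y j) ≤ m.terminalCost v (y k) := by
  induction j, hj using Nat.le_induction with
  | base => rfl
  | succ j hj ih =>
    refine le_trans ?_ ih
    rw [hy, hu j hj, ← hm.terminalCost_lqr v (y j)]
    exact le_add_of_nonneg_right (hm.stageCost_nonneg _ _ _)

end Continuation

/-! ### Tightening, value function and terminal set -/

theorem X_anti {σ σ' : ℝ} (h : σ ≤ σ') : m.X σ' ⊆ m.X σ := fun _ hx i =>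
  ⟨by linarith [(hx i).1], by linarith [(hx i).2]⟩

theorem U_anti {σ σ' : ℝ} (h : σ ≤ σ') : m.U σ' ⊆ m.U σ := fun _ hx i =>
  ⟨by linarith [(hx i).1], by linarith [(hx i).2]⟩

theorem Feasible.anti {N : ℕ} {σ σ' : ℝ} {x : Vec nx} {η : Fin N → Vec nu} (h : σ ≤ σ')
    (hη : m.Feasible σ' x η) : m.Feasible σ x η :=
  ⟨fun k => U_anti h (hη.1 k), fun k => X_anti h (hη.2 k)⟩

theorem feasibleStates_anti {N : ℕ} {σ σ' : ℝ} (h : σ ≤ σ') :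
    m.feasibleStates N σ' ⊆ m.feasibleStates N σ := fun _ ⟨η, hη⟩ => ⟨η, hη.anti h⟩

theorem IsTerminalLevel.lqr_mem {σ σ' p : ℝ} {v : Vec nv} (hp : m.IsTerminalLevel σ' v p)
    (h : σ ≤ σ') {x : Vec nx} (hx : m.terminalCost v x ≤ p) : m.lqr v x ∈ m.U σ ∧ x ∈ m.X σ :=
  ⟨U_anti h (hp.2 x hx).1, X_anti h (hp.2 x hx).2⟩

theorem Assumptions.cost_nonneg (hm : m.Assumptions) {N : ℕ} (x : Vec nx) (v : Vec nv)
    (η : Fin N → Vec nu) : 0 ≤ m.cost x v η :=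
  add_nonneg (quad_nonneg hm.posDef_P _) (Finset.sum_nonneg fun _ _ =>
    add_nonneg (quad_nonneg hm.posDef_Q _) (quad_nonneg hm.posDef_R _))

theorem Assumptions.value_le_cost (hm : m.Assumptions) {N : ℕ} {σ : ℝ} {x : Vec nx} {v : Vec nv}
    {η : Fin N → Vec nu} (hη : m.Feasible σ x η) : m.value N σ x v ≤ m.cost x v η :=
  csInf_le ⟨0, by rintro _ ⟨η', _, rfl⟩; exact hm.cost_nonneg _ _ _⟩ ⟨η, hη, rfl⟩

theorem IsOptimal.value_eq {N : ℕ} {σ : ℝ} {x : Vec nx} {v : Vec nv}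
    {η : Fin N → Vec nu} (hη : m.IsOptimal σ x v η) : m.value N σ x v = m.cost x v η :=
  IsLeast.csInf_eq ⟨⟨η, hη.1, rfl⟩, by rintro _ ⟨η', h', rfl⟩; exact hη.2 η' h'⟩

/-- If the optimal value is at most `d p`, then the optimal terminal state lies in the terminal
set. -/
theorem IsOptimal.terminalCost_le [NeZero nx] (hm : m.Assumptions) {N : ℕ} {σ σ' p : ℝ}
    {x : Vec nx} {v : Vec nv} {η : Fin N → Vec nu} (hη : m.IsOptimal σ x v η)
    (hp : m.IsTerminalLevel σ' v p) (hσ : σ ≤ σ') (hV : m.cost x v η ≤ m.d N * p) :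
    m.terminalCost v (m.pred x η N) ≤ p := by
  obtain ⟨y, u, hy0, hy, huη, -⟩ := exists_lqr_continuation (m := m) x v η le_rfl
  have hη_eq : η = fun k : Fin N => u k := funext fun k => (huη k k.2).symm
  subst hy0 hη_eq
  rw [pred_eq_of_dynamics hy N le_rfl]
  by_contra! hlt
  have hfeas := (feasible_iff_of_dynamics hy σ).1 hη.1
  -- Had the optimal trajectory entered the terminal set at step `k`, switching to LQR there would
  -- be feasible and cost at most the first `k` stages plus `p`. This beats a plan ending outside
  -- the set.
  have hall : ∀ k ≤ N, p < m.terminalCost v (y k) := by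
    intro k hk
    by_contra! hle
    obtain ⟨y', u', hy0', hy', hu', hlqr⟩ :=
      exists_lqr_continuation (m := m) (y 0) v (fun k : Fin N => u k) hk
    have hyy : ∀ j ≤ k, y' j = y j := by
      intro j hj
      induction j with
      | zero => exact hy0'
      | succ j ih => rw [hy', hy, ih (by omega), hu' j (by omega)]
    have hterm : ∀ j, k ≤ j → m.terminalCost v (y' j) ≤ p := fun j hj =>
      (hm.terminalCost_le_of_lqr hy' hlqr hj).trans (by rwa [hyy k le_rfl])
    have hfeas' : m.Feasible σ (y 0) (fun k : Fin N => u' k) := by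
      rw [← hy0', feasible_iff_of_dynamics hy']
      intro j hj
      rcases lt_or_ge j k with hjk | hjk
      · rw [hu' j hjk, hyy (j + 1) hjk]
        exact hfeas j hj
      · rw [hlqr j hjk]
        exact ⟨(hp.lqr_mem hσ (hterm j hjk)).1, (hp.lqr_mem hσ (hterm (j + 1) (by omega))).2⟩
    have hle' := hη.2 _ hfeas'
    rw [cost_eq_of_dynamics hy, ← hy0', cost_eq_of_dynamics hy',
      hm.sum_stageCost_add_terminalCost hy' hlqr hk, hyy k le_rfl] at hle'
    have hsum : ∑ j ∈ Finset.range k, m.stageCost v (y' j) (u' j) =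
        ∑ j ∈ Finset.range k, m.stageCost v (y j) (u j) :=
      Finset.sum_congr rfl fun j hj => by
        rw [Finset.mem_range] at hj
        rw [hyy j hj.le, hu' j hj]
    have hmono : ∑ j ∈ Finset.range k, m.stageCost v (y j) (u j) ≤
        ∑ j ∈ Finset.range N, m.stageCost v (y j) (u j) :=
      Finset.sum_le_sum_of_subset_of_nonneg (Finset.range_mono hk)
        fun j _ _ => hm.stageCost_nonneg _ _ _
    linarith
  have hP := lamMax_pos hm.posDef_P
  have hQ := lamMin_pos hm.posDef_Q
  -- Origin of `d`: outside the terminal set each of the `N` stages costs at least this much, and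
  -- the terminal cost exceeds `p`.
  have hstage : ∀ j ∈ Finset.range N, lamMin m.Q / lamMax m.P * p ≤ m.stageCost v (y j) (u j) := by
    intro j hj
    have h1 := (hall j (Finset.mem_range.1 hj).le).le.trans
      (quad_le_lamMax_mul_norm_sq hm.posDef_P _)
    have h2 := lamMin_mul_norm_sq_le_quad hm.posDef_Q (y j - act m.Gx v)
    have h3 : p / lamMax m.P ≤ ‖y j - act m.Gx v‖ ^ 2 := by
      rw [div_le_iff₀ hP]; linarith
    calc lamMin m.Q / lamMax m.P * p = lamMin m.Q * (p / lamMax m.P) := by ring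
      _ ≤ lamMin m.Q * ‖y j - act m.Gx v‖ ^ 2 := mul_le_mul_of_nonneg_left h3 hQ.le
      _ ≤ m.stageCost v (y j) (u j) := h2.trans (le_add_of_nonneg_right (quad_nonneg hm.posDef_R _))
  have hsum := Finset.card_nsmul_le_sum _ _ _ hstage
  rw [Finset.card_range, nsmul_eq_mul] at hsum
  rw [cost_eq_of_dynamics hy] at hV
  have hd : m.d N * p = N * (lamMin m.Q / lamMax m.P * p) + p := by rw [d]; ring
  linarith

/-- Along the optimal first input, the optimal value decreases by at least the stage cost. -/
theorem IsOptimal.exists_feasible_successor (hm : m.Assumptions) {N : ℕ} [NeZero N] {σ σ' p : ℝ}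
    {x : Vec nx} {v : Vec nv} {η : Fin N → Vec nu} (hη : m.IsOptimal σ x v η)
    (hp : m.IsTerminalLevel σ' v p) (hσ : σ ≤ σ')
    (hterm : m.terminalCost v (m.pred x η N) ≤ p) :
    act m.A x + act m.B (η 0) ∈ m.feasibleStates N σ ∧
      m.value N σ (act m.A x + act m.B (η 0)) v + m.stageCost v x (η 0) ≤ m.value N σ x v := by
  obtain ⟨y, u, hy0, hy, huη, hlqr⟩ := exists_lqr_continuation (m := m) x v η le_rfl
  have hη_eq : η = fun k : Fin N => u k := funext fun k => (huη k k.2).symm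
  rw [hη.value_eq]
  subst hy0 hη_eq
  rw [pred_eq_of_dynamics hy N le_rfl] at hterm
  have hfeas := (feasible_iff_of_dynamics hy σ).1 hη.1
  have hy1 : ∀ j, y (j + 1 + 1) = act m.A (y (j + 1)) + act m.B (u (j + 1)) := fun j => hy (j + 1)
  have hterm' : ∀ j, N ≤ j → m.terminalCost v (y j) ≤ p := fun j hj =>
    (hm.terminalCost_le_of_lqr hy hlqr hj).trans hterm
  have h0 : act m.A (y 0) + act m.B (u ((0 : Fin N) : ℕ)) = y 1 := by
    simpa using (hy 0).symm
  -- The shifted plan's only new input is the LQR input at `y N`, a state of the terminal set.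
  have hfeas' : m.Feasible σ (y 1) (fun k : Fin N => u (k + 1)) := by
    refine (feasible_iff_of_dynamics (y := fun j => y (j + 1)) hy1 σ).2 fun j hj => ?_
    rcases lt_or_ge (j + 1) N with hjN | hjN
    · exact hfeas (j + 1) hjN
    · rw [hlqr _ hjN]
      exact ⟨(hp.lqr_mem hσ (hterm' _ hjN)).1, (hp.lqr_mem hσ (hterm' _ (by omega))).2⟩
  have hval := hm.value_le_cost (v := v) hfeas'
  rw [cost_eq_of_dynamics (y := fun j => y (j + 1)) (u := fun j => u (j + 1)) hy1 v] at hval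
  -- The appended LQR step is cost-neutral, so the shift saves exactly stage `0`.
  have hsum := hm.sum_stageCost_add_terminalCost hy hlqr (Nat.le_succ N)
  rw [Finset.sum_range_succ'] at hsum
  rw [cost_eq_of_dynamics hy]
  simp only [h0]
  refine ⟨⟨_, hfeas'⟩, ?_⟩
  simp only [Fin.val_zero] at *
  linarith

end TrackingMPC

/-! ### Contraction of `psi` and bounds on deviations from equilibrium -/

namespace TrackingMPC

variable {nx nu nv cx cu : ℕ} {m : TrackingMPC nx nu nv cx cu}

theorem Assumptions.value_nonneg (hm : m.Assumptions) (N : ℕ) (σ : ℝ) (x : Vec nx) (v : Vec nv) :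
    0 ≤ m.value N σ x v :=
  Real.sInf_nonneg (by rintro _ ⟨η, _, rfl⟩; exact hm.cost_nonneg _ _ _)

theorem Assumptions.pred_equilibrium (hm : m.Assumptions) {N : ℕ} (v : Vec nv) :
    ∀ j ≤ N, m.pred (act m.Gx v) (fun _ : Fin N => act m.Gu v) j = act m.Gx v :=
  pred_eq_of_dynamics (y := fun _ => act m.Gx v) (u := fun _ => act m.Gu v)
    fun _ => (hm.act_equilibrium v).symm

theorem Assumptions.feasible_equilibrium (hm : m.Assumptions) {N : ℕ} {v : Vec nv}
    (hv : v ∈ m.refs) : m.Feasible 0 (act m.Gx v) (fun _ : Fin N => act m.Gu v) := by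
  have h := interior_subset (hm.equilibrium_mem v hv)
  refine ⟨fun _ => h.2, fun k => ?_⟩
  rw [hm.pred_equilibrium v _ k.2]
  exact h.1

theorem Assumptions.psi_equilibrium (hm : m.Assumptions) {N : ℕ} {v : Vec nv}
    (hv : v ∈ m.refs) : m.psi N 0 (act m.Gx v) v = 0 := by
  have h := hm.value_le_cost (v := v) (hm.feasible_equilibrium (N := N) hv)
  have hc := cost_eq_of_dynamics (N := N) (y := fun _ => act m.Gx v) (u := fun _ => act m.Gu v)
    (fun _ => (hm.act_equilibrium v).symm) v
  simp only [stageCost, terminalCost, sub_self, quad_zero, add_zero, Finset.sum_const_zero] at hc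
  exact Real.sqrt_eq_zero'.2 (h.trans hc.le)

theorem IsValueLipschitzConst.psi_le (hm : m.Assumptions) {N : ℕ} {β : ℝ}
    (hβ : m.IsValueLipschitzConst N β) {x : Vec nx} {v : Vec nv} (hv : v ∈ m.refs)
    (hx : x ∈ m.feasibleStates N 0) : m.psi N 0 x v ≤ β * ‖x - act m.Gx v‖ := by
  have h := hβ 0 le_rfl x hx _ ⟨_, hm.feasible_equilibrium hv⟩ v hv v hv
  rw [hm.psi_equilibrium hv, sub_zero, norm_theta_sub] at h
  exact (le_abs_self _).trans h

/-- Along the optimal first input, `ψ⁰` contracts with the factor `1 - α₁`. -/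
theorem IsOptimal.psi_successor_le [NeZero nx] (hm : m.Assumptions) {N : ℕ} [NeZero N]
    {β : ℝ} (hβ : 1 < β) (hβL : m.IsValueLipschitzConst N β) {σ p : ℝ} {x : Vec nx} {v : Vec nv}
    (hv : v ∈ m.refs) {η : Fin N → Vec nu} (hη : m.IsOptimal 0 x v η)
    (hp : m.IsTerminalLevel σ v p) (hσ : 0 ≤ σ)
    (hterm : m.terminalCost v (m.pred x η N) ≤ p) :
    m.psi N 0 (act m.A x + act m.B (η 0)) v ≤ (1 - alpha1 m β) * m.psi N 0 x v := by
  have hdec := (hη.exists_feasible_successor hm hp hσ hterm).2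
  have hQ := lamMin_pos hm.posDef_Q
  have hle := hβL.psi_le hm hv ⟨η, hη.1⟩
  have hV : m.value N 0 x v ≤ β ^ 2 * ‖x - act m.Gx v‖ ^ 2 := by
    rw [← mul_pow]
    exact (Real.sqrt_le_left (by positivity)).1 hle
  have hstage : lamMin m.Q * ‖x - act m.Gx v‖ ^ 2 ≤ m.stageCost v x (η 0) :=
    (lamMin_mul_norm_sq_le_quad hm.posDef_Q _).trans
      (le_add_of_nonneg_right (quad_nonneg hm.posDef_R _))
  have hdiv : lamMin m.Q / β ^ 2 * m.value N 0 x v ≤ lamMin m.Q * ‖x - act m.Gx v‖ ^ 2 := by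
    calc lamMin m.Q / β ^ 2 * m.value N 0 x v
        ≤ lamMin m.Q / β ^ 2 * (β ^ 2 * ‖x - act m.Gx v‖ ^ 2) := by gcongr
      _ = lamMin m.Q * ‖x - act m.Gx v‖ ^ 2 := by field_simp
  -- Only the value has to be nonnegative here; the sign of `1 - lamMin m.Q / β ^ 2` plays no role.
  rw [alpha1, sub_sub_cancel, psi, psi, ← Real.sqrt_mul' _ (hm.value_nonneg N 0 x v)]
  exact Real.sqrt_le_sqrt (by linarith)

theorem IsOptimal.norm_sub_le (hm : m.Assumptions) [NeZero nx] {N : ℕ} [NeZero N] {σ : ℝ}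
    {x : Vec nx} {v : Vec nv} {η : Fin N → Vec nu} (hη : m.IsOptimal σ x v η) :
    ‖x - act m.Gx v‖ ≤ m.psi N σ x v / Real.sqrt (lamMin (m.Hchi N)) ∧
      ‖η 0 - act m.Gu v‖ ≤ m.psi N σ x v / Real.sqrt (lamMin (m.Hchi N)) := by
  have hH := lamMin_pos (hm.posDef_Hchi N)
  have hstage : m.stageCost v x (η 0) ≤ m.value N σ x v := by
    rw [hη.value_eq, cost]
    have := Finset.single_le_sum (f := fun k : Fin N =>
      quad m.Q (m.pred x η (k : ℕ) - act m.Gx v) + quad m.R (η k - act m.Gu v))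
      (fun k _ => hm.stageCost_nonneg v (m.pred x η (k : ℕ)) (η k)) (Finset.mem_univ 0)
    simp only [Fin.val_zero, pred] at this
    exact this.trans (le_add_of_nonneg_left (quad_nonneg hm.posDef_P _))
  have hq := quad_nonneg hm.posDef_Q (x - act m.Gx v)
  have hr := quad_nonneg hm.posDef_R (η 0 - act m.Gu v)
  rw [stageCost] at hstage
  rw [psi, ← Real.sqrt_div (hm.value_nonneg N σ x v)]
  constructor
  · refine Real.le_sqrt_of_sq_le ((le_div_iff₀ hH).2 ?_)
    linarith [hm.lamMin_Hchi_le_quad_Q (0 : Fin N) (x - act m.Gx v)]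
  · refine Real.le_sqrt_of_sq_le ((le_div_iff₀ hH).2 ?_)
    linarith [hm.lamMin_Hchi_le_quad_R (0 : Fin N) (η 0 - act m.Gu v)]

end TrackingMPC

/-! ### Iterates and accuracy of the returned input -/

namespace Optimizer

variable {nx nu nv cx cu N : ℕ} {W : Type*} {opt : Optimizer nx nu nv N W}

theorem exists_isIterates (opt : Optimizer nx nu nv N W) (σ : ℝ) (x : Vec nx) (v : Vec nv)
    (w0 : W) : ∃ w : ℕ → W, w 0 = w0 ∧ opt.IsIterates σ x v w := by
  -- Each step may depend on the whole past, so the recursion builds histories; `hstable` says that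
  -- later ones extend earlier ones.
  let hist : (j : ℕ) → Fin (j + 1) → W := fun j => Nat.rec (fun _ => w0)
    (fun i h => Fin.snoc (α := fun _ => W) h (opt.step σ x v i h)) j
  have hsucc : ∀ j, hist (j + 1) = Fin.snoc (α := fun _ => W) (hist j) (opt.step σ x v j (hist j)) :=
    fun _ => rfl
  have hstable : ∀ j (i : Fin (j + 1)), hist j i = hist i (Fin.last i) := by
    intro j
    induction j with
    | zero => intro i; obtain rfl := Fin.fin_one_eq_zero i; rfl
    | succ j ih =>
      intro i
      induction i using Fin.lastCases with
      | last => rfl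
      | cast i => rw [hsucc, Fin.snoc_castSucc, ih i]; rfl
  refine ⟨fun j => hist j (Fin.last j), rfl, fun j => ?_⟩
  change hist (j + 1) (Fin.last (j + 1)) = _
  rw [hsucc, Fin.snoc_last]
  exact congrArg _ (funext (hstable j))

/-- Existence of a minimizer comes from convergence of the optimizer, with no compactness argument.
-/
theorem IsAdmissible.exists_isOptimal [TopologicalSpace W] [NeZero N]
    {m : TrackingMPC nx nu nv cx cu} (hopt : opt.IsAdmissible m) (w0 : W) {σ : ℝ} (hσ : 0 ≤ σ)
    {x : Vec nx} {v : Vec nv} (hx : x ∈ m.feasibleStates N σ) (hv : v ∈ m.refs) :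
    ∃ η : Fin N → Vec nu, m.IsOptimal σ x v η := by
  obtain ⟨w, -, hw⟩ := opt.exists_isIterates σ x v w0
  obtain ⟨ws, -, hws⟩ := hopt.converges σ x v w hσ hx hv hw
  exact ⟨_, hws⟩

/-- The first input that is returned differs from an optimal one by at most the tightening. -/
theorem Returns.exists_isOptimal_norm_le [TopologicalSpace W] [T2Space W] [NeZero N]
    {m : TrackingMPC nx nu nv cx cu} (hopt : opt.IsAdmissible m) {σ : ℝ} (hσ : 0 ≤ σ)
    {x : Vec nx} {v : Vec nv} (hx : x ∈ m.feasibleStates N σ) (hv : v ∈ m.refs) {w0 w : W}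
    (hw : opt.Returns σ x v w0 w) :
    ∃ η : Fin N → Vec nu, m.IsOptimal σ x v η ∧ ‖opt.inputs σ x v w 0 - η 0‖ ≤ σ := by
  obtain ⟨it, -, hit, hret⟩ := hw
  obtain ⟨ws, htends, hopt_ws⟩ := hopt.converges σ x v it hσ hx hv hit
  refine ⟨_, hopt_ws, ?_⟩
  rcases hret with ⟨j, hj, rfl⟩ | ⟨rfl, -, hlim⟩
  · exact abs_le_of_sq_le_sq' ((hopt.subopt_bound σ x v it j hσ hx hv hit hj _ hopt_ws).trans
      hj.1.1) hσ |>.2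
  -- If the loop never ends, the output is the limit itself (`W` is Hausdorff), so the error is
  -- zero.
  · rw [tendsto_nhds_unique hlim htends, sub_self, norm_zero]

end Optimizer

/-! ### The two coupled estimates -/

theorem lemma1 {nx nu nv cx cu N : ℕ} [NeZero nx] [NeZero N]
    (m : TrackingMPC nx nu nv cx cu) (hm : m.Assumptions)
    (β φ : ℝ) (hβ : 1 < β)
    (hβL : m.IsValueLipschitzConst N β) (hφL : m.IsInputLipschitzConst N φ)
    (π₁ π₂ : ℝ) (hπ₁ : 0 < π₁ ∧ π₁ < 1) (hπ₂ : 0 < π₂ ∧ π₂ < 1)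
    {W : Type*} [TopologicalSpace W] [T2Space W]
    (opt : Optimizer nx nu nv N W) (hopt : opt.IsAdmissible m)
    -- the constant reference, and the levels defining the two sets
    (v : Vec nv) (hv : v ∈ m.refs) (σc ψc p : ℝ)
    (hp : m.IsTerminalLevel σc v p)
    (hΓ : m.GamCheck N v ψc ⊆ m.Gam N σc v p)
    (hψc : ψc ≤ Real.sqrt (m.d N * p))
    -- states, tightening parameters and optimizer outputs of the closed loop around time `t`
    (x : ℕ → Vec nx) (S : ℕ → ℝ) (t : ℕ) (w0 w : W)
    (hS0 : 0 ≤ S t)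
    (hmem : (x t, S t) ∈ m.GamCheck N v ψc ×ˢ Set.Iic σc)
    (hw : opt.Returns (S t) (x t) v w0 w)
    (hx : x (t + 1) = act m.A (x t) + act m.B (opt.inputs (S t) (x t) v w 0))
    (hS : S (t + 1) = π₁ * S t + π₂ * ‖theta (x (t + 1)) v - theta (x t) v‖) :
    (x (t + 1) ∈ m.feasibleStates N 0 →
      m.psi N 0 (x (t + 1)) v ≤
        (1 - alpha1 m β) * m.psi N 0 (x t) v + zeta1 m β φ * S t) ∧
    S (t + 1) ≤ (1 - alpha2 m φ π₁ π₂) * S t + zeta2 m N π₂ * m.psi N 0 (x t) v := by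
  obtain ⟨⟨hx0, hψ⟩, hSσ⟩ := hmem
  simp only at hx0 hψ
  have hSσ : S t ≤ σc := hSσ
  -- Feasibility at the larger tightening `σc` implies it at `S t`.
  have hxS : x t ∈ m.feasibleStates N (S t) :=
    TrackingMPC.feasibleStates_anti hSσ (hΓ ⟨hx0, hψ⟩).1
  obtain ⟨ηS, hηS, hin⟩ := hw.exists_isOptimal_norm_le hopt hS0 hxS hv
  obtain ⟨η, hη⟩ := hopt.exists_isOptimal w0 le_rfl hx0 hv
  have herr : ‖opt.inputs (S t) (x t) v w 0 - η 0‖ ≤ (φ + 1) * S t := by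
    have h := hφL (S t) 0 hS0 le_rfl (x t) v hv ηS η hηS hη
    rw [sub_zero, abs_of_nonneg hS0] at h
    linarith [norm_sub_le_norm_sub_add_norm_sub (opt.inputs (S t) (x t) v w 0) (ηS 0) (η 0)]
  have hBerr : ‖act m.B (opt.inputs (S t) (x t) v w 0 - η 0)‖ ≤
      sigmaMax m.B * ((φ + 1) * S t) :=
    (norm_act_le _ _).trans (mul_le_mul_of_nonneg_left herr (sigmaMax_nonneg _))
  constructor
  · intro hx1
    have hd : 0 < m.d N := by
      have := lamMin_pos hm.posDef_Q
      have := lamMax_pos hm.posDef_P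
      unfold TrackingMPC.d
      positivity
    have hcost : m.cost (x t) v η ≤ m.d N * p := by
      rw [← hη.value_eq]
      exact (Real.sqrt_le_sqrt_iff (mul_pos hd hp.1).le).1 (hψ.trans hψc)
    have hterm := hη.terminalCost_le hm hp (hS0.trans hSσ) hcost
    have hfeas := (hη.exists_feasible_successor hm hp (hS0.trans hSσ) hterm).1
    have hcontr := hη.psi_successor_le hm hβ hβL hv hp (hS0.trans hSσ) hterm
    -- Compares the actual successor with the one under the exact input; the Lipschitz bound
    -- requires both to be feasible.
    have hlip := (le_abs_self _).trans (hβL 0 le_rfl _ hx1 _ hfeas v hv v hv)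
    have hdiff : x (t + 1) - (act m.A (x t) + act m.B (η 0)) =
        act m.B (opt.inputs (S t) (x t) v w 0 - η 0) := by
      rw [hx, act_sub]; abel
    rw [norm_theta_sub, hdiff] at hlip
    have hmul := mul_le_mul_of_nonneg_left hBerr (zero_le_one.trans hβ.le)
    calc m.psi N 0 (x (t + 1)) v
        ≤ (1 - alpha1 m β) * m.psi N 0 (x t) v + β * (sigmaMax m.B * ((φ + 1) * S t)) := by linarith
      _ = _ := by rw [zeta1]; ring
  · obtain ⟨hnx, hnu⟩ := hη.norm_sub_le hm
    have hdiff : x (t + 1) - x t = act (m.A - 1) (x t - act m.Gx v) + act m.B (η 0 - act m.Gu v) +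
        act m.B (opt.inputs (S t) (x t) v w 0 - η 0) := by
      have heq := hm.act_equilibrium v
      simp only [hx, act_sub, sub_act, one_act]
      -- The equilibrium equation, as an expression equal to zero, replaces the `0` of the goal so
      -- that all terms cancel.
      rw [← sub_eq_zero] at heq ⊢
      rw [← heq]
      abel
    have h1 := (norm_act_le (m.A - 1) (x t - act m.Gx v)).trans
      (mul_le_mul_of_nonneg_left hnx (sigmaMax_nonneg _))
    have h2 := (norm_act_le m.B (η 0 - act m.Gu v)).trans
      (mul_le_mul_of_nonneg_left hnu (sigmaMax_nonneg _))
    have hnorm := mul_le_mul_of_nonneg_left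
      (norm_add₃_le.trans (add_le_add (add_le_add h1 h2) hBerr)) hπ₂.1.le
    rw [← hdiff] at hnorm
    rw [hS, norm_theta_sub]
    refine (add_le_add_right hnorm _).trans_eq ?_
    rw [alpha2, zeta2]
    ring
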